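/- Write points of $\mathbb R^6$ as $\xi=(\xi_{11},\xi_{12},\xi_{21},\xi_{22},\xi_{31},\xi_{32})$ and let $|\cdot|$ be the Euclidean norm. For a convex body (compact convex set) $K\subset\mathbb R^6$ with the origin in its interior let $\|x\|_K=\min\{a\ge 0 : x\in aK\}$ be its Minkowski functional. Call $K$ $R_\theta$-invariant if for every $\theta\in[0,2\pi]$ and every $\xi\in\mathbb R^6$ one has $\|\xi\|_K=\|(R_\theta(\xi_{11},\xi_{12}),R_\theta(\xi_{21},\xi_{22}),R_\theta(\xi_{31},\xi_{32}))\|_K$, where $R_\theta$ is the counterclockwise rotation of $\mathbb R^2$ by the angle $\theta$; call $K$ infinitely smooth if the restriction of $\|\cdot\|_K$ to the unit sphere $S^5$ is $C^\infty$. A tempered distribution $f$ on $\mathbb R^6$ is positive definite if $\langle f,\varphi*\widetilde\varphi\rangle\ge 0$ for every complex-valued Schwartz function $\varphi$, where $\widetilde\varphi(x)=\overline{\varphi(-x)}$. Lemma. There is an infinitely smooth $R_\theta$-invariant convex body $K$ in $\mathbb R^6$, with the origin in its interior and contained in the open unit ball, such that the function $$x\longmapsto \frac{\|x\|_K^{-2}}{1-\left(\frac{|x|}{\|x\|_K}\right)^2}$$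 defines, by integration, a tempered distribution on $\mathbb R^6$ that is not positive definite. -/

import Mathlib

open MeasureTheory Metric
open scoped SchwartzMap Manifold ContDiff ComplexOrder ComplexConjugate

noncomputable section

/-- Euclidean six-space `ℝ⁶`, with coordinates `(ξ₁₁, ξ₁₂, ξ₂₁, ξ₂₂, ξ₃₁, ξ₃₂)`. -/
abbrev R6 : Type := EuclideanSpace ℝ (Fin 6)

/-- The counterclockwise rotation by the angle `θ` applied to each of the three coordinate pairs
`(ξ₁₁, ξ₁₂)`, `(ξ₂₁, ξ₂₂)`, `(ξ₃₁, ξ₃₂)`. -/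
def rot6 (θ : ℝ) (ξ : R6) : R6 :=
  !₂[Real.cos θ * ξ 0 - Real.sin θ * ξ 1, Real.sin θ * ξ 0 + Real.cos θ * ξ 1,
     Real.cos θ * ξ 2 - Real.sin θ * ξ 3, Real.sin θ * ξ 2 + Real.cos θ * ξ 3,
     Real.cos θ * ξ 4 - Real.sin θ * ξ 5, Real.sin θ * ξ 4 + Real.cos θ * ξ 5]

/-- `K` is `R_θ`-invariant: its Minkowski functional is unchanged under all the coordinate-wise
rotations. -/
def IsRotationInvariant (K : Set R6) : Prop :=
  ∀ θ ∈ Set.Icc 0 (2 * Real.pi), ∀ ξ : R6, gauge K ξ = gauge K (rot6 θ ξ)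

/-- `K` is infinitely smooth: the restriction of its Minkowski functional to the unit sphere is
a `C^∞` function on the sphere. -/
def IsInfinitelySmooth (K : Set R6) : Prop :=
  ContMDiff (𝓡 5) 𝓘(ℝ, ℝ) ∞ (fun x : sphere (0 : R6) 1 => gauge K (x : R6))

/-- The function `‖x‖_K⁻² / (1 - (|x| / ‖x‖_K)²)`. -/
def density (K : Set R6) (x : R6) : ℝ :=
  (gauge K x ^ 2)⁻¹ / (1 - (‖x‖ / gauge K x) ^ 2)

/-- The tempered distribution `T` is the one given by integration against the function `f`. -/
def IsGivenBy (T : 𝓢'(R6, ℂ)) (f : R6 → ℝ) : Prop :=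
  ∀ φ : 𝓢(R6, ℂ), Integrable (fun x => (f x : ℂ) * φ x) ∧ T φ = ∫ x, (f x : ℂ) * φ x

/-- The test function `x ↦ conj (φ (-x))`. -/
def conjReflect (φ : 𝓢(R6, ℂ)) : 𝓢(R6, ℂ) :=
  SchwartzMap.postcompCLM (Complex.conjCLE : ℂ →L[ℝ] ℂ)
    (SchwartzMap.compCLMOfContinuousLinearEquiv ℂ (ContinuousLinearEquiv.neg ℝ) φ)

theorem conjReflect_apply (φ : 𝓢(R6, ℂ)) (x : R6) : conjReflect φ x = conj (φ (-x)) := rfl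

/-- A tempered distribution `T` is positive definite if `⟨T, φ ∗ conj (φ (-·))⟩ ≥ 0` for every
test function `φ` (in particular, this number is real). -/
def IsPositiveDefinite (T : 𝓢'(R6, ℂ)) : Prop :=
  ∀ φ : 𝓢(R6, ℂ),
    0 ≤ T (SchwartzMap.convolution (ContinuousLinearMap.mul ℂ ℂ) φ (conjReflect φ))

end

/-!
Write `A = |ξ₁|²` and `B = |ξ₂|² + |ξ₃|²`, so that `|ξ|² = A + B`. The density of a body equals
`(‖ξ‖_K² - |ξ|²)⁻¹`, and `K` is chosen so that it is `3 / (A + B) - 1 / (A + B / 2)`; the resulting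
`‖ξ‖_K²` is a maximum of nonnegative quadratic forms, hence `K` is an intersection of ellipsoids.

The Fourier transform of `1 / (A + m B)` on `ℝ⁶` is a positive multiple, independent of `m`, of
`m⁻² (A + B / m)⁻²`. On the plane `B = 0` the transform of the density is therefore a positive
multiple of `(3 - 4) A⁻² < 0`. This is detected by testing against the autocorrelation of a Gaussian
modulated to a frequency in that plane, and the pairing is computed from `1 / q = ∫₀^∞ e^{-s q} ds`.
-/

noncomputable section

theorem gauge_ofPred_le_one_of_homogeneous {E : Type*} [AddCommGroup E] [Module ℝ E] {p : E → ℝ}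
    (hp0 : ∀ x, 0 ≤ p x) (hp : ∀ r > 0, ∀ x, p (r • x) = r * p x) :
    gauge {x | p x ≤ 1} = p := by
  ext x
  have hset : {r ∈ Set.Ioi (0 : ℝ) | r⁻¹ • x ∈ {x | p x ≤ 1}} = {r | 0 < r ∧ p x ≤ r} := by
    ext r
    refine and_congr_right fun hr : 0 < r => ?_
    rw [Set.mem_ofPred_eq, hp _ (inv_pos.2 hr), inv_mul_le_iff₀ hr, mul_one]
  rw [gauge_def', hset]
  refine csInf_eq_of_forall_ge_of_forall_gt_exists_lt ⟨p x + 1, by grind⟩ (fun r hr => hr.2)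
    fun w hw => ?_
  obtain ⟨r, hr, hrw⟩ := exists_between hw
  exact ⟨r, ⟨(hp0 x).trans_lt hr, hr.le⟩, hrw⟩

section WeightedNormSq

variable {ι : Type*} [Fintype ι] {w w' : ι → ℝ}

/-- The diagonal quadratic form `∑ i, w i * x i ^ 2` on Euclidean space. -/
def weightedNormSq (w : ι → ℝ) (x : EuclideanSpace ℝ ι) : ℝ := ∑ i, w i * x i ^ 2

theorem weightedNormSq_const (c : ℝ) (x : EuclideanSpace ℝ ι) :
    weightedNormSq (fun _ => c) x = c * ‖x‖ ^ 2 := by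
  rw [weightedNormSq, EuclideanSpace.real_norm_sq_eq, Finset.mul_sum]

theorem weightedNormSq_mono (h : ∀ i, w i ≤ w' i) (x : EuclideanSpace ℝ ι) :
    weightedNormSq w x ≤ weightedNormSq w' x :=
  Finset.sum_le_sum fun i _ => mul_le_mul_of_nonneg_right (h i) (sq_nonneg _)

theorem weightedNormSq_pos (hw : ∀ i, 0 < w i) {x : EuclideanSpace ℝ ι} (hx : x ≠ 0) :
    0 < weightedNormSq w x := by
  obtain ⟨i, hi⟩ : ∃ i, x i ≠ 0 := by
    contrapose! hx
    exact PiLp.ext hx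
  exact Finset.sum_pos' (fun j _ => mul_nonneg (hw j).le (sq_nonneg _))
    ⟨i, Finset.mem_univ i, mul_pos (hw i) (by positivity)⟩

theorem weightedNormSq_smul (w : ι → ℝ) (r : ℝ) (x : EuclideanSpace ℝ ι) :
    weightedNormSq w (r • x) = r ^ 2 * weightedNormSq w x := by
  simp only [weightedNormSq, Finset.mul_sum, PiLp.smul_apply, smul_eq_mul]
  exact Finset.sum_congr rfl fun i _ => by ring

theorem contDiff_weightedNormSq (w : ι → ℝ) : ContDiff ℝ ∞ (weightedNormSq w) := by
  unfold weightedNormSq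
  fun_prop

theorem convexOn_weightedNormSq (hw : ∀ i, 0 ≤ w i) :
    ConvexOn ℝ Set.univ (weightedNormSq w) := by
  have hsum : weightedNormSq w = ∑ i, fun x : EuclideanSpace ℝ ι => w i • x i ^ 2 := by
    ext x
    simp [weightedNormSq]
  rw [hsum]
  refine Finset.sum_induction _ (ConvexOn ℝ Set.univ) (fun _ _ => ConvexOn.add)
    (convexOn_const 0 convex_univ) fun i _ => ?_
  exact ((even_two.convexOn_pow (𝕜 := ℝ)).comp_linearMap
    (EuclideanSpace.proj (𝕜 := ℝ) i : EuclideanSpace ℝ ι →L[ℝ] ℝ).toLinearMap).smul (hw i)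

theorem ae_weightedNormSq_pos [Nonempty ι] (hw : ∀ i, 0 < w i) :
    ∀ᵐ x : EuclideanSpace ℝ ι, 0 < weightedNormSq w x := by
  filter_upwards [Measure.ae_ne volume 0] with x hx using weightedNormSq_pos hw hx

theorem integral_exp_neg_weightedNormSq_mul_cexp_inner_mul_I (hw : ∀ i, 0 < w i)
    (v : EuclideanSpace ℝ ι) :
    ∫ x, (Real.exp (-weightedNormSq w x) : ℂ) * Complex.exp ((inner ℝ v x : ℝ) * Complex.I) =
      (∏ i, √(Real.pi / w i) * Real.exp (-v i ^ 2 / (4 * w i)) : ℝ) := by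
  have hgauss := GaussianFourier.integral_cexp_neg_sum_mul_add (b := fun i => (w i : ℂ))
    (by simpa using hw) (fun i => v i * Complex.I)
  rw [← (PiLp.volume_preserving_toLp ι).integral_comp
    (MeasurableEquiv.toLp 2 _).measurableEmbedding]
  calc _ = ∫ x : ι → ℝ, Complex.exp (-∑ i, w i * (x i : ℂ) ^ 2 + ∑ i, v i * Complex.I * x i) := by
        refine integral_congr_ae (Filter.Eventually.of_forall fun x => ?_)
        simp only [weightedNormSq, PiLp.inner_apply]
        rw [Complex.ofReal_exp, ← Complex.exp_add]
        push_cast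
        rw [Finset.sum_mul]
        congr! 3 with i
        simp only [RCLike.inner_apply, Real.ringHom_apply, Complex.ofReal_mul]
        ring
    _ = _ := by
        rw [hgauss]
        push_cast
        refine Finset.prod_congr rfl fun i _ => ?_
        congr 1
        · rw [Real.sqrt_eq_rpow, Complex.ofReal_cpow (div_nonneg Real.pi_nonneg (hw i).le)]
          push_cast
          rfl
        · rw [mul_pow, Complex.I_sq, mul_neg_one]

end WeightedNormSq

section SchwartzExponential

variable {E : Type*} [NormedAddCommGroup E] [NormedSpace ℝ E] {P : E → ℂ}

theorem norm_iteratedFDeriv_cexp_le (n : ℕ) (z : ℂ) :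
    ‖iteratedFDeriv ℝ n Complex.exp z‖ ≤ Real.exp z.re := by
  induction n with
  | zero => rw [norm_iteratedFDeriv_zero, Complex.norm_exp]
  | succ n ih =>
    have hfderiv : fderiv ℝ Complex.exp = ContinuousLinearMap.mul ℝ ℂ ∘ Complex.exp := by
      ext z
      simp [((Complex.hasDerivAt_exp z).hasFDerivAt.restrictScalars ℝ).fderiv, mul_comm]
    calc ‖iteratedFDeriv ℝ (n + 1) Complex.exp z‖
        = ‖iteratedFDeriv ℝ n (ContinuousLinearMap.mul ℝ ℂ ∘ Complex.exp) z‖ := by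
          rw [← norm_iteratedFDeriv_fderiv, hfderiv]
      _ ≤ ‖ContinuousLinearMap.mul ℝ ℂ‖ * ‖iteratedFDeriv ℝ n Complex.exp z‖ :=
          (ContinuousLinearMap.mul ℝ ℂ).norm_iteratedFDeriv_comp_left
            Complex.contDiff_exp.contDiffAt le_rfl
      _ ≤ 1 * Real.exp z.re := by
          gcongr
          exact ContinuousLinearMap.opNorm_mul_le ℝ ℂ
      _ = Real.exp z.re := one_mul _

theorem exists_pow_mul_norm_iteratedFDeriv_cexp_comp_le (hP : P.HasTemperateGrowth)
    (hdecay : ∀ k : ℕ, ∃ C, ∀ x, (1 + ‖x‖) ^ k * Real.exp (P x).re ≤ C) (k n : ℕ) :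
    ∃ C, ∀ x, ‖x‖ ^ k * ‖iteratedFDeriv ℝ n (Complex.exp ∘ P) x‖ ≤ C := by
  obtain ⟨l, C, hC, hPC⟩ := hP.norm_iteratedFDeriv_le_uniform n
  obtain ⟨M, hM⟩ := hdecay (k + l * n)
  refine ⟨n.factorial * (1 + C) ^ n * M, fun x => ?_⟩
  have hbase : 1 ≤ (1 + C) * (1 + ‖x‖) ^ l :=
    one_le_mul_of_one_le_of_one_le (by linarith) (one_le_pow₀ (by linarith [norm_nonneg x]))
  have hcomp : ‖iteratedFDeriv ℝ n (Complex.exp ∘ P) x‖ ≤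
      n.factorial * Real.exp (P x).re * ((1 + C) * (1 + ‖x‖) ^ l) ^ n := by
    refine norm_iteratedFDeriv_comp_le Complex.contDiff_exp hP.1 (by exact_mod_cast le_top) x
      (fun i _ => norm_iteratedFDeriv_cexp_le i _) fun i hi hin => ?_
    calc ‖iteratedFDeriv ℝ i P x‖ ≤ C * (1 + ‖x‖) ^ l := hPC i hin x
      _ ≤ (1 + C) * (1 + ‖x‖) ^ l := by gcongr; linarith
      _ ≤ ((1 + C) * (1 + ‖x‖) ^ l) ^ i := le_self_pow₀ hbase (by omega)
  calc ‖x‖ ^ k * ‖iteratedFDeriv ℝ n (Complex.exp ∘ P) x‖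
      ≤ (1 + ‖x‖) ^ k * (n.factorial * Real.exp (P x).re * ((1 + C) * (1 + ‖x‖) ^ l) ^ n) := by
        gcongr
        linarith
    _ = n.factorial * (1 + C) ^ n * ((1 + ‖x‖) ^ (k + l * n) * Real.exp (P x).re) := by
        rw [mul_pow, pow_add, pow_mul]
        ring
    _ ≤ n.factorial * (1 + C) ^ n * M := by gcongr; exact hM x

/-- The Schwartz function `exp ∘ P`, for an exponent `P` of temperate growth whose real part tends
to `-∞` fast enough for `exp ∘ P` to decay rapidly. -/
def schwartzCexp (P : E → ℂ) (hP : P.HasTemperateGrowth)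
    (hdecay : ∀ k : ℕ, ∃ C, ∀ x, (1 + ‖x‖) ^ k * Real.exp (P x).re ≤ C) : 𝓢(E, ℂ) where
  toFun := Complex.exp ∘ P
  smooth' := Complex.contDiff_exp.comp hP.1
  decay' := exists_pow_mul_norm_iteratedFDeriv_cexp_comp_le hP hdecay

end SchwartzExponential

theorem exists_one_add_pow_mul_exp_neg_mul_sq_le {c : ℝ} (hc : 0 < c) (k : ℕ) :
    ∃ C, ∀ r : ℝ, 0 ≤ r → (1 + r) ^ k * Real.exp (-(c * r ^ 2)) ≤ C := by
  refine ⟨k.factorial * Real.exp (1 + 1 / (4 * c)), fun r hr => ?_⟩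
  have hpow : (1 + r) ^ k ≤ Real.exp (1 + r) * k.factorial :=
    (div_le_iff₀ (by positivity)).1 (Real.pow_div_factorial_le_exp (1 + r) (by positivity) k)
  have hsquare : 1 + r - c * r ^ 2 = 1 + 1 / (4 * c) - c * (r - 1 / (2 * c)) ^ 2 := by
    field_simp
    ring
  calc (1 + r) ^ k * Real.exp (-(c * r ^ 2))
      ≤ (Real.exp (1 + r) * k.factorial) * Real.exp (-(c * r ^ 2)) := by gcongr
    _ = k.factorial * Real.exp (1 + r - c * r ^ 2) := by
        rw [sub_eq_add_neg, Real.exp_add (1 + r)]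
        ring
    _ ≤ k.factorial * Real.exp (1 + 1 / (4 * c)) := by
        rw [hsquare]
        gcongr
        exact sub_le_self _ (by positivity)

section ModulatedGaussian

variable {E : Type*} [NormedAddCommGroup E] [InnerProductSpace ℝ E] {c : ℝ}

/-- The modulated Gaussian `x ↦ exp (i ⟪v, x⟫ - c ‖x‖²)`, whose Fourier transform is concentrated
near the frequency `v`. -/
def modulatedGaussian (hc : 0 < c) (v : E) : 𝓢(E, ℂ) :=
  schwartzCexp (fun x => (inner ℝ v x : ℝ) * Complex.I - (c * ‖x‖ ^ 2 : ℝ))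
    (by
      have := Function.hasTemperateGrowth_norm_sq (H := E)
      fun_prop)
    fun k => by
      obtain ⟨C, hC⟩ := exists_one_add_pow_mul_exp_neg_mul_sq_le hc k
      refine ⟨C, fun x => ?_⟩
      simpa [-Complex.ofReal_pow, -Complex.ofReal_mul] using hC ‖x‖ (norm_nonneg x)

theorem modulatedGaussian_apply (hc : 0 < c) (v x : E) :
    modulatedGaussian hc v x =
      Complex.exp ((inner ℝ v x : ℝ) * Complex.I - (c * ‖x‖ ^ 2 : ℝ)) :=
  rfl

theorem modulatedGaussian_mul_conj_sub (hc : 0 < c) (v x y : E) :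
    modulatedGaussian (mul_pos two_pos hc) v y *
        conj (modulatedGaussian (mul_pos two_pos hc) v (y - x)) =
      (Real.exp (-(4 * c) * ‖y - (1 / 2 : ℝ) • x‖ ^ 2) : ℂ) * modulatedGaussian hc v x := by
  have hinner : inner ℝ v y - inner ℝ v (y - x) = inner ℝ v x := by rw [inner_sub_right]; ring
  have hnorm : 2 * c * ‖y‖ ^ 2 + 2 * c * ‖y - x‖ ^ 2 =
      4 * c * ‖y - (1 / 2 : ℝ) • x‖ ^ 2 + c * ‖x‖ ^ 2 := by
    rw [norm_sub_sq_real, norm_sub_sq_real, inner_smul_right, norm_smul]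
    norm_num
    ring
  simp only [modulatedGaussian_apply, ← Complex.exp_conj, Complex.ofReal_exp, ← Complex.exp_add,
    map_sub, map_mul, Complex.conj_ofReal, Complex.conj_I]
  congr 1
  rw [← hinner, eq_comm, ← sub_eq_zero]
  have := congrArg Complex.ofReal hnorm
  push_cast at this ⊢
  linear_combination this

theorem integral_modulatedGaussian_mul_conj_sub [FiniteDimensional ℝ E] [MeasurableSpace E]
    [BorelSpace E] (hc : 0 < c) (v x : E) :
    ∫ y, modulatedGaussian (mul_pos two_pos hc) v y *
        conj (modulatedGaussian (mul_pos two_pos hc) v (y - x)) =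
      ((Real.pi / (4 * c)) ^ (Module.finrank ℝ E / 2 : ℝ) : ℝ) * modulatedGaussian hc v x := by
  simp only [modulatedGaussian_mul_conj_sub hc]
  rw [integral_mul_const, integral_complex_ofReal,
    integral_sub_right_eq_self fun y : E => Real.exp (-(4 * c) * ‖y‖ ^ 2),
    GaussianFourier.integral_rexp_neg_mul_sq_norm (by positivity)]

end ModulatedGaussian

theorem convolution_modulatedGaussian_conjReflect {c : ℝ} (hc : 0 < c) (v : R6) :
    SchwartzMap.convolution (ContinuousLinearMap.mul ℂ ℂ)
        (modulatedGaussian (mul_pos two_pos hc) v)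
        (conjReflect (modulatedGaussian (mul_pos two_pos hc) v)) =
      (((Real.pi / (4 * c)) ^ 3 : ℝ) : ℂ) • modulatedGaussian hc v := by
  ext x
  rw [SchwartzMap.convolution_apply, convolution_def]
  simp only [ContinuousLinearMap.mul_apply', conjReflect_apply, neg_sub]
  rw [integral_modulatedGaussian_mul_conj_sub hc, finrank_euclideanSpace_fin,
    smul_apply, smul_eq_mul]
  norm_num

section TemperedDistribution

variable {E : Type*} [NormedAddCommGroup E] [NormedSpace ℝ E] [FiniteDimensional ℝ E]
  [MeasurableSpace E] [BorelSpace E] (μ : Measure E) [μ.IsAddHaarMeasure]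

theorem integrable_inv_norm_pow_mul_one_add_norm_rpow {k : ℕ} (hk : k < Module.finrank ℝ E) :
    Integrable (fun x => (‖x‖ ^ k)⁻¹ * (1 + ‖x‖) ^ (-((Module.finrank ℝ E + 1 : ℕ) : ℝ))) μ := by
  have : Nontrivial E := Module.nontrivial_of_finrank_pos (R := ℝ) (by omega)
  set n := Module.finrank ℝ E
  rw [integrable_fun_norm_addHaar μ
    (f := fun r : ℝ => (r ^ k)⁻¹ * (1 + r) ^ (-((n + 1 : ℕ) : ℝ)))]
  refine (integrableOn_add_rpow_Ioi_of_lt (a := -2) (c := 0) (m := 1) (by norm_num)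
    (by norm_num)).mono' (by fun_prop : Measurable _).aestronglyMeasurable ?_
  filter_upwards [ae_restrict_mem measurableSet_Ioi] with r hr
  have hr : 0 < r := hr
  have hpow : r ^ (n - 1) * (r ^ k)⁻¹ ≤ (1 + r) ^ (n - 1) := by
    rw [← pow_sub₀ r hr.ne' (by omega)]
    calc r ^ (n - 1 - k) ≤ (1 + r) ^ (n - 1 - k) := by gcongr; linarith
      _ ≤ (1 + r) ^ (n - 1) := pow_le_pow_right₀ (by linarith) (Nat.sub_le _ _)
  calc ‖r ^ (n - 1) • ((r ^ k)⁻¹ * (1 + r) ^ (-((n + 1 : ℕ) : ℝ)))‖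
      = r ^ (n - 1) * (r ^ k)⁻¹ * (1 + r) ^ (-((n + 1 : ℕ) : ℝ)) := by
        rw [Real.norm_of_nonneg (by positivity), smul_eq_mul, mul_assoc]
    _ ≤ (1 + r) ^ (n - 1) * (1 + r) ^ (-((n + 1 : ℕ) : ℝ)) := by gcongr
    _ = (r + 1) ^ (-2 : ℝ) := by
        rw [← Real.rpow_natCast, ← Real.rpow_add (by positivity), add_comm 1 r,
          Nat.cast_sub (by omega)]
        congr 1
        push_cast
        ring

theorem hasTemperateGrowth_withDensity_of_le_inv_norm_pow {f : E → ℝ} {C : ℝ} {k : ℕ}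
    (hk : k < Module.finrank ℝ E) (hf : Measurable f) (hf0 : ∀ x, 0 ≤ f x)
    (hfC : ∀ x, f x ≤ C * (‖x‖ ^ k)⁻¹) :
    (μ.withDensity fun x => ENNReal.ofReal (f x)).HasTemperateGrowth := by
  refine ⟨Module.finrank ℝ E + 1, ?_⟩
  rw [integrable_withDensity_iff_integrable_smul' hf.ennreal_ofReal (by simp)]
  refine ((integrable_inv_norm_pow_mul_one_add_norm_rpow μ hk).const_mul C).mono'
    (by fun_prop : Measurable _).aestronglyMeasurable (Filter.Eventually.of_forall fun x => ?_)
  rw [ENNReal.toReal_ofReal (hf0 x), smul_eq_mul,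
    Real.norm_of_nonneg (mul_nonneg (hf0 x) (by positivity)), ← mul_assoc]
  gcongr
  exact hfC x

end TemperedDistribution

theorem exists_isGivenBy_of_le_inv_norm_pow {f : R6 → ℝ} {C : ℝ} {k : ℕ} (hk : k < 6)
    (hf : Measurable f) (hf0 : ∀ x, 0 ≤ f x) (hfC : ∀ x, f x ≤ C * (‖x‖ ^ k)⁻¹) :
    ∃ T, IsGivenBy T f := by
  have := hasTemperateGrowth_withDensity_of_le_inv_norm_pow volume
    (hk.trans_eq (finrank_euclideanSpace_fin (𝕜 := ℝ)).symm) hf hf0 hfC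
  set μ : Measure R6 := volume.withDensity fun x => ENNReal.ofReal (f x)
  refine ⟨μ.toTemperedDistribution, fun φ => ?_⟩
  have happly : μ.toTemperedDistribution φ = ∫ x, φ x ∂μ := rfl
  have hφ := φ.integrable (μ := μ)
  rw [integrable_withDensity_iff_integrable_smul' hf.ennreal_ofReal (by simp)] at hφ
  rw [happly, integral_withDensity_eq_integral_toReal_smul hf.ennreal_ofReal (by simp)]
  simp only [ENNReal.toReal_ofReal (hf0 _), Complex.real_smul, and_true] at hφ ⊢
  exact hφ

namespace IsGivenBy

variable {S T : 𝓢'(R6, ℂ)} {f g : R6 → ℝ}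

theorem const_smul (hT : IsGivenBy T f) (c : ℝ) :
    IsGivenBy ((c : ℂ) • T) fun x => c * f x := by
  intro φ
  simp only [Complex.ofReal_mul, mul_assoc, smul_apply, smul_eq_mul, (hT φ).2]
  exact ⟨(hT φ).1.const_mul _, (integral_const_mul _ _).symm⟩

theorem sub (hS : IsGivenBy S f) (hT : IsGivenBy T g) :
    IsGivenBy (S - T) fun x => f x - g x := by
  intro φ
  simp only [Complex.ofReal_sub, sub_mul]
  refine ⟨(hS φ).1.sub (hT φ).1, ?_⟩
  rw [integral_sub (hS φ).1 (hT φ).1, ← (hS φ).2, ← (hT φ).2]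
  rfl

end IsGivenBy

theorem exists_isGivenBy_inv_weightedNormSq {w : Fin 6 → ℝ} (hw : ∀ i, 0 < w i) :
    ∃ T, IsGivenBy T fun x => (weightedNormSq w x)⁻¹ := by
  obtain ⟨i, hi⟩ := Finite.exists_min w
  have hlower (x : R6) : w i * ‖x‖ ^ 2 ≤ weightedNormSq w x := by
    rw [← weightedNormSq_const]
    exact weightedNormSq_mono hi x
  refine exists_isGivenBy_of_le_inv_norm_pow (C := (w i)⁻¹) (k := 2) (by norm_num)
    (contDiff_weightedNormSq w).continuous.measurable.inv (fun x => ?_) fun x => ?_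
  · exact inv_nonneg.2 ((mul_nonneg (hw i).le (sq_nonneg _)).trans (hlower x))
  · rcases eq_or_ne x 0 with rfl | hx
    · simp [weightedNormSq]
    · rw [← mul_inv]
      exact inv_anti₀ (mul_pos (hw i) (by positivity)) (hlower x)

theorem integral_exp_neg_mul_Ioi_zero {q : ℝ} (hq : 0 < q) :
    ∫ s in Set.Ioi (0 : ℝ), Real.exp (-q * s) = q⁻¹ := by
  rw [integral_exp_mul_Ioi (by linarith)]
  simp [neg_div_neg_eq]

section LaplaceSuperposition

variable {α F : Type*} [MeasurableSpace α] {μ : Measure α} [NormedAddCommGroup F]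
  [NormedSpace ℝ F] {q : α → ℝ} {g : α → F}

theorem integrable_prod_exp_neg_mul_smul (hq : ∀ᵐ x ∂μ, 0 < q x) (hqm : AEMeasurable q μ)
    (hg : AEStronglyMeasurable g μ) (hqg : Integrable (fun x => (q x)⁻¹ • g x) μ) :
    Integrable (fun p : α × ℝ => Real.exp (-q p.1 * p.2) • g p.1)
      (μ.prod (volume.restrict (Set.Ioi 0))) := by
  have hmeas : AEStronglyMeasurable (fun p : α × ℝ => Real.exp (-q p.1 * p.2) • g p.1)
      (μ.prod (volume.restrict (Set.Ioi 0))) := by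
    have := hqm.comp_fst (ν := volume.restrict (Set.Ioi (0 : ℝ)))
    exact AEStronglyMeasurable.smul (by fun_prop : AEMeasurable _ _).aestronglyMeasurable
      hg.comp_fst
  refine (integrable_prod_iff hmeas).2 ⟨?_, hqg.norm.congr ?_⟩
  · filter_upwards [hq] with x hx
    exact (integrableOn_exp_mul_Ioi (neg_lt_zero.2 hx) 0).smul_const (g x)
  · filter_upwards [hq] with x hx
    simp only [norm_smul, Real.norm_of_nonneg (Real.exp_pos _).le]
    rw [integral_mul_const, integral_exp_neg_mul_Ioi_zero hx,
      Real.norm_of_nonneg (inv_pos.2 hx).le]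

theorem integral_inv_smul_eq_integral_Ioi_integral_exp_smul [SFinite μ] [CompleteSpace F]
    (hq : ∀ᵐ x ∂μ, 0 < q x) (hqm : AEMeasurable q μ) (hg : AEStronglyMeasurable g μ)
    (hqg : Integrable (fun x => (q x)⁻¹ • g x) μ) :
    ∫ x, (q x)⁻¹ • g x ∂μ = ∫ s in Set.Ioi (0 : ℝ), ∫ x, Real.exp (-q x * s) • g x ∂μ := by
  rw [← integral_integral_swap (integrable_prod_exp_neg_mul_smul hq hqm hg hqg)]
  refine integral_congr_ae ?_
  filter_upwards [hq] with x hx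
  rw [integral_smul_const, integral_exp_neg_mul_Ioi_zero hx]

end LaplaceSuperposition

section Body

/-- The squared norm `|ξ₁|²` of the first coordinate pair. -/
def headSq (x : R6) : ℝ := x 0 ^ 2 + x 1 ^ 2

/-- The squared norm `|ξ₂|² + |ξ₃|²` of the last two coordinate pairs. -/
def tailSq (x : R6) : ℝ := x 2 ^ 2 + x 3 ^ 2 + x 4 ^ 2 + x 5 ^ 2

/-- The weights of a diagonal form that only sees `headSq` and `tailSq`. -/
def splitWeights (a b : ℝ) : Fin 6 → ℝ := ![a, a, b, b, b, b]

/-- The quadratic form `a |ξ₁|² + b (|ξ₂|² + |ξ₃|²)`. -/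
def splitForm (a b : ℝ) : R6 → ℝ := weightedNormSq (splitWeights a b)

theorem splitForm_eq (a b : ℝ) (x : R6) : splitForm a b x = a * headSq x + b * tailSq x := by
  simp only [splitForm, splitWeights, weightedNormSq, headSq, tailSq, Fin.sum_univ_six,
    Matrix.cons_val]
  ring

theorem forall_splitWeights {p : ℝ → Prop} {a b : ℝ} (ha : p a) (hb : p b) (i : Fin 6) :
    p (splitWeights a b i) := by
  fin_cases i <;> assumption

theorem splitForm_pos {a b : ℝ} (ha : 0 < a) (hb : 0 < b) {x : R6} (hx : x ≠ 0) :
    0 < splitForm a b x :=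
  weightedNormSq_pos (forall_splitWeights ha hb) hx

theorem exists_isGivenBy_inv_splitForm {a b : ℝ} (ha : 0 < a) (hb : 0 < b) :
    ∃ T, IsGivenBy T fun x => (splitForm a b x)⁻¹ :=
  exists_isGivenBy_inv_weightedNormSq (forall_splitWeights ha hb)

theorem headSq_nonneg (x : R6) : 0 ≤ headSq x := by unfold headSq; positivity

theorem tailSq_nonneg (x : R6) : 0 ≤ tailSq x := by unfold tailSq; positivity

theorem norm_sq_eq_splitForm (x : R6) : ‖x‖ ^ 2 = splitForm 1 1 x := by
  simp only [splitForm_eq, EuclideanSpace.real_norm_sq_eq, Fin.sum_univ_six, headSq, tailSq]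
  ring

theorem splitForm_rot6 (a b θ : ℝ) (x : R6) : splitForm a b (rot6 θ x) = splitForm a b x := by
  simp only [splitForm_eq, headSq, tailSq, rot6, Matrix.cons_val]
  linear_combination (a * (x 0 ^ 2 + x 1 ^ 2) + b * (x 2 ^ 2 + x 3 ^ 2 + x 4 ^ 2 + x 5 ^ 2)) *
    Real.sin_sq_add_cos_sq θ

/-- The squared Minkowski functional of the body. It is chosen so that
`(bodyNormSq - |·|²)⁻¹ = 3 / (|ξ₁|² + |ξ₂|² + |ξ₃|²) - 1 / (|ξ₁|² + (|ξ₂|² + |ξ₃|²) / 2)`. -/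
def bodyNormSq (x : R6) : ℝ :=
  ‖x‖ ^ 2 + splitForm 1 1 x * splitForm 1 (1 / 2) x / (2 * splitForm 1 (1 / 4) x)

theorem bodyNormSq_smul (r : ℝ) (x : R6) : bodyNormSq (r • x) = r ^ 2 * bodyNormSq x := by
  rcases eq_or_ne r 0 with rfl | hr
  · simp [bodyNormSq, splitForm, weightedNormSq]
  · simp only [bodyNormSq, norm_sq_eq_splitForm, splitForm, weightedNormSq_smul]
    field_simp

theorem norm_sq_lt_bodyNormSq {x : R6} (hx : x ≠ 0) : ‖x‖ ^ 2 < bodyNormSq x := by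
  have h1 := splitForm_pos one_pos one_pos hx
  have h2 := splitForm_pos one_pos (b := 1 / 2) (by norm_num) hx
  have h3 := splitForm_pos one_pos (b := 1 / 4) (by norm_num) hx
  exact lt_add_of_pos_right _ (by positivity)

-- With `A = headSq x`, `B = tailSq x` and `D = 4 A + B`, the body is given by `2 B + 6 A ^ 2 / D`,
-- and `A ^ 2 / D = 2 l A - l ^ 2 D + (A - l D) ^ 2 / D`.
theorem bodyNormSq_eq_splitForm_add (l : ℝ) {x : R6} (hx : x ≠ 0) :
    bodyNormSq x = splitForm (12 * l * (1 - 2 * l)) (2 - 6 * l ^ 2) x +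
      6 * (headSq x - l * splitForm 4 1 x) ^ 2 / splitForm 4 1 x := by
  have hD := splitForm_pos (a := 4) (by norm_num) one_pos hx
  have hquarter : 2 * splitForm 1 (1 / 4) x = splitForm 4 1 x / 2 := by
    simp only [splitForm_eq]
    ring
  rw [bodyNormSq, norm_sq_eq_splitForm, hquarter, div_div_eq_mul_div]
  refine mul_right_cancel₀ hD.ne' ?_
  rw [add_mul, div_mul_cancel₀ _ hD.ne', add_mul, div_mul_cancel₀ _ hD.ne']
  simp only [splitForm_eq]
  ring

theorem bodyNormSq_le_one_iff (x : R6) :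
    bodyNormSq x ≤ 1 ↔ ∀ l ∈ Set.Icc (0 : ℝ) (1 / 4),
      splitForm (12 * l * (1 - 2 * l)) (2 - 6 * l ^ 2) x ≤ 1 := by
  rcases eq_or_ne x 0 with rfl | hx
  · simp [bodyNormSq, splitForm, weightedNormSq]
  have hD := splitForm_pos (a := 4) (by norm_num) one_pos hx
  constructor
  · intro h l _
    have : 0 ≤ 6 * (headSq x - l * splitForm 4 1 x) ^ 2 / splitForm 4 1 x := by positivity
    linarith [bodyNormSq_eq_splitForm_add l hx]
  · intro h
    have hl : headSq x / splitForm 4 1 x ∈ Set.Icc (0 : ℝ) (1 / 4) := by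
      refine ⟨div_nonneg (headSq_nonneg x) hD.le, ?_⟩
      rw [div_le_iff₀ hD, splitForm_eq]
      linarith [tailSq_nonneg x]
    rw [bodyNormSq_eq_splitForm_add (headSq x / splitForm 4 1 x) hx, div_mul_cancel₀ _ hD.ne']
    simpa using h _ hl

/-- The convex body as a set. -/
def bodySet : Set R6 := {x | bodyNormSq x ≤ 1}

theorem bodySet_eq_iInter : bodySet = ⋂ l ∈ Set.Icc (0 : ℝ) (1 / 4),
    {x | splitForm (12 * l * (1 - 2 * l)) (2 - 6 * l ^ 2) x ≤ 1} := by
  ext x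
  simp only [bodySet, Set.mem_ofPred_eq, bodyNormSq_le_one_iff, Set.mem_iInter]

theorem convex_bodySet : Convex ℝ bodySet := by
  rw [bodySet_eq_iInter]
  refine convex_iInter₂ fun l hl => ?_
  have hhead : 0 ≤ 12 * l * (1 - 2 * l) := mul_nonneg (by linarith [hl.1]) (by linarith [hl.2])
  have htail : 0 ≤ 2 - 6 * l ^ 2 := by nlinarith [hl.1, hl.2]
  simpa [splitForm] using (convexOn_weightedNormSq (forall_splitWeights hhead htail)).convex_le 1

theorem isClosed_bodySet : IsClosed bodySet := by
  rw [bodySet_eq_iInter]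
  exact isClosed_biInter fun l _ =>
    isClosed_le (contDiff_weightedNormSq _).continuous continuous_const

theorem bodySet_subset_ball : bodySet ⊆ ball 0 1 := by
  intro x hx
  rcases eq_or_ne x 0 with rfl | hx0
  · exact mem_ball_self one_pos
  · rw [mem_ball_zero_iff, ← sq_lt_one_iff₀ (norm_nonneg x)]
    exact (norm_sq_lt_bodyNormSq hx0).trans_le hx

theorem ball_subset_bodySet : ball 0 (1 / 2) ⊆ bodySet := by
  intro x hx
  rw [mem_ball_zero_iff] at hx
  refine (bodyNormSq_le_one_iff x).2 fun l hl => ?_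
  have hweights : ∀ i, splitWeights (12 * l * (1 - 2 * l)) (2 - 6 * l ^ 2) i ≤ 2 :=
    forall_splitWeights (p := (· ≤ 2)) (by nlinarith [hl.1, hl.2]) (by nlinarith [hl.1])
  calc splitForm (12 * l * (1 - 2 * l)) (2 - 6 * l ^ 2) x ≤ 2 * ‖x‖ ^ 2 := by
        rw [← weightedNormSq_const]
        exact weightedNormSq_mono hweights x
    _ ≤ 2 * (1 / 2) ^ 2 := by gcongr
    _ ≤ 1 := by norm_num

theorem zero_mem_interior_bodySet : (0 : R6) ∈ interior bodySet :=
  interior_maximal ball_subset_bodySet isOpen_ball (mem_ball_self (by norm_num))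

/-- The convex body whose density is not positive definite. -/
def body : ConvexBody R6 where
  carrier := bodySet
  convex' := convex_bodySet
  isCompact' := (isCompact_closedBall (0 : R6) 1).of_isClosed_subset isClosed_bodySet
    (bodySet_subset_ball.trans ball_subset_closedBall)
  nonempty' := ⟨0, interior_subset zero_mem_interior_bodySet⟩

theorem gauge_bodySet : gauge bodySet = fun x => √(bodyNormSq x) := by
  have hset : bodySet = {x | √(bodyNormSq x) ≤ 1} := by simp [bodySet, Real.sqrt_le_one]
  rw [hset]
  refine gauge_ofPred_le_one_of_homogeneous (fun x => Real.sqrt_nonneg _) fun r hr x => ?_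
  rw [bodyNormSq_smul, Real.sqrt_mul (sq_nonneg r), Real.sqrt_sq hr.le]

theorem isRotationInvariant_bodySet : IsRotationInvariant bodySet := by
  intro θ _ ξ
  simp only [gauge_bodySet, bodyNormSq, norm_sq_eq_splitForm, splitForm_rot6]

theorem isInfinitelySmooth_of_contDiffAt {K : Set R6}
    (hK : ∀ x ≠ 0, ContDiffAt ℝ ∞ (gauge K) x) : IsInfinitelySmooth K := by
  have : Fact (Module.finrank ℝ R6 = 5 + 1) := ⟨finrank_euclideanSpace_fin⟩
  intro x
  exact ContMDiffAt.comp (g := gauge K) (I' := 𝓘(ℝ, R6)) x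
    (hK x (ne_zero_of_mem_unit_sphere x)).contMDiffAt (contMDiff_coe_sphere (E := R6) (n := 5) x)

theorem isInfinitelySmooth_bodySet : IsInfinitelySmooth bodySet := by
  refine isInfinitelySmooth_of_contDiffAt fun x hx => ?_
  have hsmooth (b : ℝ) : ContDiffAt ℝ ∞ (splitForm 1 b) x :=
    (contDiff_weightedNormSq _).contDiffAt
  have hquarter := splitForm_pos one_pos (b := 1 / 4) (by norm_num) hx
  rw [gauge_bodySet]
  refine ContDiffAt.sqrt ?_ ((sq_nonneg _).trans_lt (norm_sq_lt_bodyNormSq hx)).ne'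
  exact (contDiff_norm_sq ℝ).contDiffAt.add (((hsmooth 1).mul (hsmooth (1 / 2))).div
    (contDiffAt_const.mul (hsmooth (1 / 4))) (by positivity))

theorem density_eq_inv_sub {K : Set R6} {x : R6} (hx : gauge K x ≠ 0) :
    density K x = (gauge K x ^ 2 - ‖x‖ ^ 2)⁻¹ := by
  rw [density, div_eq_mul_inv, ← mul_inv, mul_sub, mul_one, div_pow,
    mul_div_cancel₀ _ (pow_ne_zero 2 hx)]

theorem density_bodySet (x : R6) :
    density bodySet x = 3 * (splitForm 1 1 x)⁻¹ - (splitForm 1 (1 / 2) x)⁻¹ := by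
  rcases eq_or_ne x 0 with rfl | hx
  · simp [density, splitForm, weightedNormSq]
  have h1 := splitForm_pos one_pos one_pos hx
  have h2 := splitForm_pos one_pos (b := 1 / 2) (by norm_num) hx
  have hlin : 2 * splitForm 1 (1 / 4) x = 3 * splitForm 1 (1 / 2) x - splitForm 1 1 x := by
    simp only [splitForm_eq]
    ring
  have hN : 0 < bodyNormSq x := (sq_nonneg _).trans_lt (norm_sq_lt_bodyNormSq hx)
  rw [density_eq_inv_sub (by rw [gauge_bodySet]; exact (Real.sqrt_pos.2 hN).ne'), gauge_bodySet,
    Real.sq_sqrt hN.le, bodyNormSq, add_sub_cancel_left, inv_div, hlin]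
  field_simp

end Body

section GaussianTransform

variable {ι : Type*} [Fintype ι]

/-- The integral of `exp (-s * weightedNormSq w x)` against the modulated Gaussian
`exp (i ⟪v, x⟫ - c ‖x‖²)`. -/
def gaussianTransform (w : ι → ℝ) (c : ℝ) (v : EuclideanSpace ℝ ι) (s : ℝ) : ℝ :=
  ∏ i, √(Real.pi / (c + s * w i)) * Real.exp (-v i ^ 2 / (4 * (c + s * w i)))

theorem weightedNormSq_const_add_mul (w : ι → ℝ) (c s : ℝ) (x : EuclideanSpace ℝ ι) :
    weightedNormSq (fun i => c + s * w i) x = c * ‖x‖ ^ 2 + s * weightedNormSq w x := by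
  rw [← weightedNormSq_const]
  simp only [weightedNormSq, Finset.mul_sum, ← Finset.sum_add_distrib]
  exact Finset.sum_congr rfl fun i _ => by ring

theorem integral_exp_neg_weightedNormSq_smul_modulatedGaussian {w : ι → ℝ} {c s : ℝ}
    (hw : ∀ i, 0 ≤ w i) (hc : 0 < c) (hs : 0 ≤ s) (v : EuclideanSpace ℝ ι) :
    ∫ x, Real.exp (-weightedNormSq w x * s) • modulatedGaussian hc v x =
      (gaussianTransform w c v s : ℂ) := by
  have hweights (i : ι) : 0 < c + s * w i := by
    have := hw i
    positivity
  rw [gaussianTransform, ← integral_exp_neg_weightedNormSq_mul_cexp_inner_mul_I hweights]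
  refine integral_congr_ae (Filter.Eventually.of_forall fun x => ?_)
  simp only [modulatedGaussian_apply, weightedNormSq_const_add_mul, Complex.real_smul,
    Complex.ofReal_exp, ← Complex.exp_add]
  congr 1
  push_cast
  ring

variable {w : Fin 6 → ℝ} {T : 𝓢'(R6, ℂ)} {c : ℝ}

theorem IsGivenBy.integrable_inv_smul (hT : IsGivenBy T fun x => (weightedNormSq w x)⁻¹)
    (φ : 𝓢(R6, ℂ)) : Integrable fun x => (weightedNormSq w x)⁻¹ • φ x := by
  simpa only [Complex.real_smul] using (hT φ).1

theorem integrableOn_gaussianTransform (hw : ∀ i, 0 < w i) (hc : 0 < c) (v : R6) :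
    IntegrableOn (gaussianTransform w c v) (Set.Ioi 0) := by
  obtain ⟨T, hT⟩ := exists_isGivenBy_inv_weightedNormSq hw
  have hprod := integrable_prod_exp_neg_mul_smul (ae_weightedNormSq_pos hw)
    (contDiff_weightedNormSq w).continuous.aemeasurable
    (modulatedGaussian hc v).continuous.aestronglyMeasurable (hT.integrable_inv_smul _)
  refine hprod.integral_prod_right.re.congr ?_
  filter_upwards [ae_restrict_mem measurableSet_Ioi] with s hs
  rw [integral_exp_neg_weightedNormSq_smul_modulatedGaussian (fun i => (hw i).le) hc
    (Set.mem_Ioi.1 hs).le]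
  rfl

theorem IsGivenBy.apply_modulatedGaussian (hT : IsGivenBy T fun x => (weightedNormSq w x)⁻¹)
    (hw : ∀ i, 0 < w i) (hc : 0 < c) (v : R6) :
    T (modulatedGaussian hc v) = (∫ s in Set.Ioi 0, gaussianTransform w c v s : ℝ) := by
  simp only [(hT _).2, ← Complex.real_smul]
  rw [integral_inv_smul_eq_integral_Ioi_integral_exp_smul (ae_weightedNormSq_pos hw)
    (contDiff_weightedNormSq w).continuous.aemeasurable
    (modulatedGaussian hc v).continuous.aestronglyMeasurable (hT.integrable_inv_smul _),
    ← integral_complex_ofReal]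
  exact setIntegral_congr_fun measurableSet_Ioi fun s hs =>
    integral_exp_neg_weightedNormSq_smul_modulatedGaussian (fun i => (hw i).le) hc
      (Set.mem_Ioi.1 hs).le v

end GaussianTransform

section Negativity

/-- The transform of `splitForm 1 m` at the frequency `(8, 0, 0, 0, 0, 0)`. This frequency is high
enough for the Gaussian spread not to spoil the sign of the Fourier transform on `ξ₂ = ξ₃ = 0`. -/
def axisTransform (m : ℝ) : ℝ → ℝ :=
  gaussianTransform (splitWeights 1 m) 1 (EuclideanSpace.single 0 8)

theorem axisTransform_eq {m s : ℝ} (hm : 0 < m) (hs : 0 < s) :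
    axisTransform m s =
      Real.pi ^ 3 / ((1 + s) * (1 + s * m) ^ 2) * Real.exp (-16 / (1 + s)) := by
  have hhead : √(Real.pi / (1 + s)) ^ 2 = Real.pi / (1 + s) := Real.sq_sqrt (by positivity)
  have htail : √(Real.pi / (1 + s * m)) ^ 2 = Real.pi / (1 + s * m) := Real.sq_sqrt (by positivity)
  have hexp : -8 ^ 2 / (4 * (1 + s)) = -16 / (1 + s) := by
    field_simp
    norm_num
  calc axisTransform m s
      = √(Real.pi / (1 + s)) ^ 2 * (√(Real.pi / (1 + s * m)) ^ 2) ^ 2 *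
          Real.exp (-8 ^ 2 / (4 * (1 + s))) := by
        simp only [axisTransform, gaussianTransform, splitWeights, PiLp.single_apply,
          Fin.prod_univ_six, Matrix.cons_val, Fin.isValue, Fin.reduceEq, ↓reduceIte, mul_one,
          neg_zero, zero_div, Real.exp_zero, ne_eq, OfNat.ofNat_ne_zero, not_false_eq_true,
          zero_pow]
        ring
    _ = Real.pi ^ 3 / ((1 + s) * (1 + s * m) ^ 2) * Real.exp (-16 / (1 + s)) := by
        rw [hhead, htail, hexp]
        field_simp

theorem integrableOn_axisTransform {m : ℝ} (hm : 0 < m) :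
    IntegrableOn (axisTransform m) (Set.Ioi 0) :=
  integrableOn_gaussianTransform (forall_splitWeights one_pos hm) one_pos _

-- The frequency `8` is what makes `(8 / t ^ 4 - 1 / t ^ 3) * exp (-16 / t)` an exact derivative.
theorem hasDerivAt_exp_div_sq {s : ℝ} (hs : 0 ≤ s) :
    HasDerivAt (fun s : ℝ => Real.exp (-16 / (1 + s)) / (2 * (1 + s) ^ 2))
      ((8 / (1 + s) ^ 4 - 1 / (1 + s) ^ 3) * Real.exp (-16 / (1 + s))) s := by
  have hne : 1 + s ≠ 0 := by positivity
  have hbase : HasDerivAt (fun s : ℝ => 1 + s) 1 s := (hasDerivAt_id s).const_add _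
  have hquot := (((hasDerivAt_const s (-16 : ℝ)).div hbase hne).exp).div
    ((hbase.pow 2).const_mul 2) (show 2 * (1 + s) ^ 2 ≠ 0 by positivity)
  refine hquot.congr_deriv ?_
  simp only [Pi.pow_apply, Pi.div_apply]
  field_simp
  ring

theorem tendsto_exp_div_sq_atTop :
    Filter.Tendsto (fun s : ℝ => Real.exp (-16 / (1 + s)) / (2 * (1 + s) ^ 2))
      Filter.atTop (nhds 0) := by
  have hbase : Filter.Tendsto (fun s : ℝ => 1 + s) Filter.atTop Filter.atTop :=
    Filter.tendsto_atTop_add_const_left _ _ Filter.tendsto_id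
  have hexp := (Real.continuous_exp.tendsto _).comp (hbase.const_div_atTop (-16))
  exact hexp.div_atTop
    (((Filter.tendsto_pow_atTop two_ne_zero).comp hbase).const_mul_atTop two_pos)

theorem integrableOn_deriv_exp_div_sq :
    IntegrableOn (fun s : ℝ => (8 / (1 + s) ^ 4 - 1 / (1 + s) ^ 3) * Real.exp (-16 / (1 + s)))
      (Set.Ioi 0) := by
  refine ((integrableOn_axisTransform one_pos).const_mul (9 / Real.pi ^ 3)).mono'
    (by fun_prop : Measurable _).aestronglyMeasurable ?_
  filter_upwards [ae_restrict_mem measurableSet_Ioi] with s hs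
  have hs : 0 < s := hs
  have hquartic : 8 / (1 + s) ^ 4 ≤ 8 / (1 + s) ^ 3 := by
    gcongr
    · linarith
    · norm_num
  have hbound : |8 / (1 + s) ^ 4 - 1 / (1 + s) ^ 3| ≤ 9 / (1 + s) ^ 3 := by
    have h4 : 0 ≤ 8 / (1 + s) ^ 4 := by positivity
    have h3 : 0 ≤ 1 / (1 + s) ^ 3 := by positivity
    have h9 : 9 / (1 + s) ^ 3 = 8 / (1 + s) ^ 3 + 1 / (1 + s) ^ 3 := by ring
    rw [h9, abs_le]
    constructor <;> linarith
  calc ‖(8 / (1 + s) ^ 4 - 1 / (1 + s) ^ 3) * Real.exp (-16 / (1 + s))‖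
      ≤ 9 / (1 + s) ^ 3 * Real.exp (-16 / (1 + s)) := by
        rw [norm_mul, Real.norm_eq_abs, Real.norm_of_nonneg (Real.exp_pos _).le]
        gcongr
    _ = 9 / Real.pi ^ 3 * axisTransform 1 s := by
        rw [axisTransform_eq one_pos hs]
        field_simp

theorem integral_deriv_exp_div_sq :
    ∫ s in Set.Ioi (0 : ℝ), (8 / (1 + s) ^ 4 - 1 / (1 + s) ^ 3) * Real.exp (-16 / (1 + s)) =
      -(Real.exp (-16) / 2) := by
  rw [integral_Ioi_of_hasDerivAt_of_tendsto' (fun s hs => hasDerivAt_exp_div_sq hs)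
    integrableOn_deriv_exp_div_sq tendsto_exp_div_sq_atTop]
  norm_num

theorem axisTransform_sub_le {s : ℝ} (hs : 0 < s) :
    3 * axisTransform 1 s - axisTransform (1 / 2) s ≤
      Real.pi ^ 3 * ((8 / (1 + s) ^ 4 - 1 / (1 + s) ^ 3) * Real.exp (-16 / (1 + s))) := by
  have hdiff : 8 / (1 + s) ^ 4 - 1 / (1 + s) ^ 3 -
      (3 / (1 + s) ^ 3 - 1 / ((1 + s) * (1 + s * (1 / 2)) ^ 2)) =
      4 * (3 * (1 + s) + 2) / ((1 + s) ^ 4 * (2 + s) ^ 2) := by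
    field_simp
    ring
  have hrat : 3 / (1 + s) ^ 3 - 1 / ((1 + s) * (1 + s * (1 / 2)) ^ 2) ≤
      8 / (1 + s) ^ 4 - 1 / (1 + s) ^ 3 := by
    rw [← sub_nonneg, hdiff]
    positivity
  calc 3 * axisTransform 1 s - axisTransform (1 / 2) s
      = Real.pi ^ 3 * ((3 / (1 + s) ^ 3 - 1 / ((1 + s) * (1 + s * (1 / 2)) ^ 2)) *
          Real.exp (-16 / (1 + s))) := by
        rw [axisTransform_eq one_pos hs, axisTransform_eq one_half_pos hs]
        ring
    _ ≤ _ := by gcongr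

theorem integral_axisTransform_sub_neg :
    3 * (∫ s in Set.Ioi 0, axisTransform 1 s) - ∫ s in Set.Ioi 0, axisTransform (1 / 2) s < 0 := by
  have hone := (integrableOn_axisTransform one_pos).const_mul 3
  have hhalf := integrableOn_axisTransform one_half_pos
  rw [← integral_const_mul, ← integral_sub hone hhalf]
  calc ∫ s in Set.Ioi 0, 3 * axisTransform 1 s - axisTransform (1 / 2) s
      ≤ ∫ s in Set.Ioi (0 : ℝ),
          Real.pi ^ 3 * ((8 / (1 + s) ^ 4 - 1 / (1 + s) ^ 3) * Real.exp (-16 / (1 + s))) :=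
        setIntegral_mono_on (hone.sub hhalf) (integrableOn_deriv_exp_div_sq.const_mul _)
          measurableSet_Ioi fun s hs => axisTransform_sub_le hs
    _ = -(Real.pi ^ 3 * Real.exp (-16) / 2) := by
        rw [integral_const_mul, integral_deriv_exp_div_sq]
        ring
    _ < 0 := neg_lt_zero.2 (by positivity)

theorem not_isPositiveDefinite_three_smul_sub {T₁ T₂ : 𝓢'(R6, ℂ)}
    (h₁ : IsGivenBy T₁ fun x => (splitForm 1 1 x)⁻¹)
    (h₂ : IsGivenBy T₂ fun x => (splitForm 1 (1 / 2) x)⁻¹) :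
    ¬ IsPositiveDefinite (((3 : ℝ) : ℂ) • T₁ - T₂) := by
  intro hpos
  have happly : (((3 : ℝ) : ℂ) • T₁ - T₂) (modulatedGaussian one_pos (EuclideanSpace.single 0 8)) =
      (3 * (∫ s in Set.Ioi 0, axisTransform 1 s) -
        ∫ s in Set.Ioi 0, axisTransform (1 / 2) s : ℝ) := by
    have hT₁ := h₁.apply_modulatedGaussian (forall_splitWeights one_pos one_pos) one_pos
      (EuclideanSpace.single 0 8)
    have hT₂ := h₂.apply_modulatedGaussian (forall_splitWeights one_pos one_half_pos) one_pos
      (EuclideanSpace.single 0 8)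
    rw [axisTransform, axisTransform, Complex.ofReal_sub, Complex.ofReal_mul, ← hT₁, ← hT₂]
    rfl
  have htest := hpos (modulatedGaussian (mul_pos two_pos one_pos) (EuclideanSpace.single 0 8))
  rw [convolution_modulatedGaussian_conjReflect one_pos, map_smul, happly, smul_eq_mul,
    ← Complex.ofReal_mul, Complex.zero_le_real] at htest
  exact htest.not_gt (mul_neg_of_pos_of_neg (by positivity) integral_axisTransform_sub_neg)

end Negativity

end

theorem lemma9 :
    ∃ K : ConvexBody R6,
      (0 : R6) ∈ interior (K : Set R6) ∧
      (K : Set R6) ⊆ ball 0 1 ∧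
      IsRotationInvariant (K : Set R6) ∧
      IsInfinitelySmooth (K : Set R6) ∧
      ∃ T : 𝓢'(R6, ℂ), IsGivenBy T (density (K : Set R6)) ∧ ¬ IsPositiveDefinite T := by
  obtain ⟨T₁, h₁⟩ := exists_isGivenBy_inv_splitForm one_pos one_pos
  obtain ⟨T₂, h₂⟩ := exists_isGivenBy_inv_splitForm one_pos one_half_pos
  refine ⟨body, zero_mem_interior_bodySet, bodySet_subset_ball, isRotationInvariant_bodySet,
    isInfinitelySmooth_bodySet, ((3 : ℝ) : ℂ) • T₁ - T₂, ?_,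
    not_isPositiveDefinite_three_smul_sub h₁ h₂⟩
  have hdensity := (h₁.const_smul 3).sub h₂
  simp only [← density_bodySet] at hdensity
  exact hdensity
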